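/- Let $\mathfrak L$ be a finite relational language. A smooth class $(\mathcal K,\leqslant)$ consists of a class $\mathcal K$ of finite $\mathfrak L$-structures that is closed under isomorphism and substructures (HP), together with a reflexive and transitive relation $A\leqslant B$ between structures $A\subseteq B$ of $\mathcal K$ that is invariant under embeddings and satisfies: (1) $\emptyset\in\mathcal K$, and $\emptyset\leqslant A$ for all $A\in\mathcal K$; (2) if $A\subseteq B'\subseteq B$ and $A\leqslant B$, then $A\leqslant B'$; (3) if $A_1,A_2\subseteq A$ and $A_1\leqslant A$, then $A_1\cap A_2\leqslant A_2$. For an arbitrary $\mathfrak L$-structure $N$ and a finite substructure $A\subseteq N$, write $A\leqslant N$ if $A\leqslant B$ for every finite substructure $B$ of $N$ containing $A$ (for $N\in\mathcal K$ this agrees with the given relation). An embedding $\Gamma:A\to N$ is a $\leqslant$-embedding if $\Gamma[A]\leqslant N$. The class has AP if for all $A,B,C\in\mathcal K$ and $\leqslant$-embeddings $\gamma_1:A\to B$, $\gamma_2:A\to C$ there are $D\in\mathcal K$ and $\leqslant$-embeddings $\lambda_1:B\to D$, $\lambda_2:C\to D$ with $\lambda_1\circ\gamma_1=\lambda_2\circ\gamma_2$.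 A countable structure $\mathbf M$ is $(\mathcal K,\leqslant)$-generic if the finite structures embeddable in $\mathbf M$ are exactly those in $\mathcal K$; $\mathbf M=\bigcup_{i\in\omega}A_i$ with $A_i\in\mathcal K$ and $A_i\leqslant A_{i+1}$ for all $i$; and whenever $A\leqslant\mathbf M$ and $A\leqslant B\in\mathcal K$, there is a $\leqslant$-embedding $\Gamma:B\to\mathbf M$ that is the identity on $A$. For $A,B,C\in\mathcal K$ and $k\geq 1$, write $C\to(B)^A_k$ if for every map $c$ from the set of $\leqslant$-embeddings of $A$ into $C$ to $\{0,\dots,k-1\}$ there is a $\leqslant$-embedding $\lambda:B\to C$ such that $c(\lambda\circ\gamma)$ takes the same value for all $\leqslant$-embeddings $\gamma:A\to B$. The class has the $\leqslant$-Ramsey property if for all $A\leqslant B$ in $\mathcal K$ and all $k\geq 2$ there is $C\in\mathcal K$ with $B\leqslant C$ and $C\to(B)^A_k$. **Theorem.** Let $(\mathcal K,\leqslant)$ be a smooth class with AP (and HP), let $\mathbf M$ be the countable $(\mathcal K,\leqslant)$-generic structure, and let $G=\mathrm{Aut}(\mathbf M)$ with the topology of pointwise convergence, where $\mathbf M$ is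 discrete. Then the following are equivalent: (1) $G$ is extremely amenable, i.e. every continuous action of $G$ on a nonempty compact Hausdorff space has a fixed point; (2) (a) $G$ preserves a linear ordering of $\mathbf M$, i.e. there is a linear ordering $\preceq$ of $\mathbf M$ such that $a\preceq b$ implies $g(a)\preceq g(b)$ for all $a,b\in\mathbf M$ and $g\in G$; and (b) $(\mathcal K,\leqslant)$ has the $\leqslant$-Ramsey property. -/

import Mathlib

open CategoryTheory
open scoped FirstOrder

universe u v w

/-- A smooth class `(𝒦, ≤)` of finite `L`-structures.  `Closed B A` is the relation `A ≤ B` between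
a structure `B` and a substructure `A ⊆ B`; it is a relation on `𝒦`, so it entails `B ∈ 𝒦`
(and then `A ∈ 𝒦`, because `𝒦` is closed under substructures). -/
structure SmoothClass (L : FirstOrder.Language.{u, v}) where
  /-- the class `𝒦` -/
  carrier : Set (Bundled.{w} L.Structure)
  /-- `Closed B A` means `A ≤ B` -/
  Closed : ∀ (B : Type w) [L.Structure B], L.Substructure B → Prop
  finite_of_mem : ∀ B ∈ carrier, Finite B
  /-- `𝒦` is closed under isomorphism and substructures (this contains HP) -/
  hereditary : FirstOrder.Language.Hereditary carrier
  /-- `∅ ∈ 𝒦` -/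
  exists_empty : ∃ E ∈ carrier, IsEmpty E
  mem_of_closed : ∀ (B : Type w) [L.Structure B] (A : L.Substructure B),
    Closed B A → Bundled.of (c := L.Structure) B ∈ carrier
  /-- invariance under embeddings `B ≃ B' ⊆ N` -/
  closed_map_equiv : ∀ (B B' : Type w) [L.Structure B] [L.Structure B'] (e : B ≃[L] B')
    (A : L.Substructure B), Closed B A → Closed B' (A.map e.toHom)
  /-- reflexivity: `B ≤ B` -/
  closed_top : ∀ (B : Type w) [L.Structure B], Bundled.of (c := L.Structure) B ∈ carrier → Closed B ⊤
  /-- transitivity: `A ≤ B` and `B ≤ C` imply `A ≤ C` -/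
  closed_trans : ∀ (C : Type w) [L.Structure C] (B : L.Substructure C) (A : L.Substructure B),
    Closed B A → Closed C B → Closed C (A.map B.subtype.toHom)
  /-- `∅ ≤ B` -/
  closed_bot : ∀ (B : Type w) [L.Structure B], Bundled.of (c := L.Structure) B ∈ carrier → Closed B ⊥
  /-- if `A ⊆ B' ⊆ B` and `A ≤ B` then `A ≤ B'` -/
  closed_restrict : ∀ (B : Type w) [L.Structure B] (A B' : L.Substructure B),
    A ≤ B' → Closed B A → Closed B' (A.comap B'.subtype.toHom)
  /-- if `A₁, A₂ ⊆ B` and `A₁ ≤ B` then `A₁ ∩ A₂ ≤ A₂` -/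
  closed_inter : ∀ (B : Type w) [L.Structure B] (A₁ A₂ : L.Substructure B),
    Closed B A₁ → Closed A₂ ((A₁ ⊓ A₂).comap A₂.subtype.toHom)

namespace SmoothClass

variable {L : FirstOrder.Language.{u, v}} (K : SmoothClass.{u, v, w} L)

/-- `A ≤ N` for a finite substructure `A` of an arbitrary structure `N`: `A ≤ B` for every finite
substructure `B` of `N` that contains `A`.  For `N ∈ 𝒦` this is the given relation, see
`closedIn_iff_closed`. -/
def ClosedIn (N : Type w) [L.Structure N] (A : L.Substructure N) : Prop :=
  Finite A ∧ ∀ B : L.Substructure N, Finite B → A ≤ B → K.Closed B (A.comap B.subtype.toHom)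

/-- `f : A → N` is a `≤`-embedding. -/
def IsClosedEmb {A N : Type w} [L.Structure A] [L.Structure N] (f : A ↪[L] N) : Prop :=
  K.ClosedIn N f.toHom.range

/-- The set of all `≤`-embeddings of `A` into `N`. -/
def ClosedEmb (A N : Type w) [L.Structure A] [L.Structure N] : Type w :=
  {f : A ↪[L] N // K.IsClosedEmb f}

theorem closedIn_iff_closed (N : Type w) [L.Structure N] (hN : Bundled.of (c := L.Structure) N ∈ K.carrier)
    (A : L.Substructure N) : K.ClosedIn N A ↔ K.Closed N A := by
  have hfin : Finite N := K.finite_of_mem _ hN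
  constructor
  · rintro ⟨-, h⟩
    have h1 := h ⊤ (Subtype.finite) le_top
    have h2 := K.closed_trans N ⊤ _ h1 (K.closed_top N hN)
    have h3 : (A.comap (⊤ : L.Substructure N).subtype.toHom).map
        (⊤ : L.Substructure N).subtype.toHom = A := by
      ext x
      simp [FirstOrder.Language.Substructure.mem_map]
    rwa [h3] at h2
  · exact fun h => ⟨Subtype.finite, fun B _ hAB => K.closed_restrict N A B hAB h⟩

theorem IsClosedEmb.comp [L.IsRelational] {A B N : Type w} [L.Structure A] [L.Structure B]
    [L.Structure N] {g : B ↪[L] N} {f : A ↪[L] B} (hg : K.IsClosedEmb g) (hf : K.IsClosedEmb f) :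
    K.IsClosedEmb (g.comp f) := by
  obtain ⟨hgfin, hg⟩ := hg
  obtain ⟨hffin, hf⟩ := hf
  have hB : Finite B := Finite.of_equiv _ g.equivRange.toEquiv.symm
  have hA : Finite A := Finite.of_equiv _ f.equivRange.toEquiv.symm
  refine ⟨Finite.of_equiv _ (g.comp f).equivRange.toEquiv, fun D hD hAD => ?_⟩
  -- the substructure of `N` with domain `D ∪ g[B]`
  let E : L.Substructure N := FirstOrder.Language.Substructure.closure L ((D : Set N) ∪ Set.range g)
  have hEset : (E : Set N) = (D : Set N) ∪ Set.range g :=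
    FirstOrder.Language.Substructure.closure_eq_of_isRelational L _
  have hEfin : Finite E := by
    have : ((D : Set N) ∪ Set.range g).Finite := (Set.toFinite _).union (Set.finite_range g)
    rw [← hEset] at this
    exact this
  have hgE : g.toHom.range ≤ E := by
    rintro x ⟨y, rfl⟩
    have : g y ∈ (E : Set N) := by rw [hEset]; exact Or.inr ⟨y, rfl⟩
    exact this
  have hDE : D ≤ E := by
    intro x hx
    have : x ∈ (E : Set N) := by rw [hEset]; exact Or.inl hx
    exact this
  have h1 : K.Closed E (g.toHom.range.comap E.subtype.toHom) := hg E hEfin hgE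
  -- transport `f[A] ≤ B` to `g[f[A]] ≤ g[B]`
  let R := g.toHom.range.comap E.subtype.toHom
  let k : B ↪[L] E := g.codRestrict E (fun c => hgE ⟨c, rfl⟩)
  have hkR : k.toHom.range = R := by
    ext x
    constructor
    · rintro ⟨y, rfl⟩
      exact ⟨y, rfl⟩
    · rintro ⟨y, hy⟩
      exact ⟨y, Subtype.ext hy⟩
  have h1' : K.Closed E k.toHom.range := by rw [hkR]; exact h1
  have h2 : K.Closed B f.toHom.range := by
    have h3 := hf ⊤ (Subtype.finite) le_top
    have h4 := K.closed_map_equiv _ _ (FirstOrder.Language.Substructure.topEquiv (L := L) (M := B)) _ h3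
    convert h4 using 1
    ext x
    simp [FirstOrder.Language.Substructure.mem_map]
  have h5 := K.closed_map_equiv _ _ k.equivRange _ h2
  have h6 := K.closed_trans _ _ _ h5 h1'
  let D' : L.Substructure E := D.comap E.subtype.toHom
  have h7 := K.closed_inter E _ D' h6
  -- `D'` is isomorphic to `D`
  let e : D' ≃[L] D :=
    { toFun := fun x => ⟨x.1.1, x.2⟩
      invFun := fun x => ⟨⟨x.1, hDE x.2⟩, x.2⟩
      left_inv := fun _ => rfl
      right_inv := fun _ => rfl
      map_fun' := fun {n} F => isEmptyElim F
      map_rel' := fun _ _ => Iff.rfl }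
  have h8 := K.closed_map_equiv _ _ e _ h7
  convert h8 using 1
  ext x
  constructor
  · rintro ⟨a, ha⟩
    refine ⟨⟨⟨x.1, hDE x.2⟩, x.2⟩, ⟨⟨k.equivRange (f a), ⟨f a, ⟨a, rfl⟩, rfl⟩, ?_⟩, x.2⟩, rfl⟩
    exact Subtype.ext ha
  · rintro ⟨y, ⟨⟨z, ⟨b, ⟨a, rfl⟩, rfl⟩, hz⟩, -⟩, rfl⟩
    exact ⟨a, congrArg Subtype.val hz⟩

variable {K} in
/-- The composition of `≤`-embeddings. -/
def ClosedEmb.comp [L.IsRelational] {A B N : Type w} [L.Structure A] [L.Structure B]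
    [L.Structure N] (g : K.ClosedEmb B N) (f : K.ClosedEmb A B) : K.ClosedEmb A N :=
  ⟨g.1.comp f.1, IsClosedEmb.comp K g.2 f.2⟩

/-- The `≤`-amalgamation property (AP). -/
def Amalgamation : Prop :=
  ∀ A ∈ K.carrier, ∀ B ∈ K.carrier, ∀ C ∈ K.carrier,
    ∀ (γ₁ : K.ClosedEmb A B) (γ₂ : K.ClosedEmb A C),
    ∃ D ∈ K.carrier, ∃ (δ₁ : K.ClosedEmb B D) (δ₂ : K.ClosedEmb C D),
      δ₁.1.comp γ₁.1 = δ₂.1.comp γ₂.1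

/-- `M` is the (countable) `(𝒦, ≤)`-generic structure. -/
structure IsGeneric (M : Type w) [L.Structure M] : Prop where
  countable : Countable M
  /-- the finite structures that embed into `M` are those in `𝒦` -/
  age_eq : L.age M = K.carrier
  /-- `M` is the union of a chain `A₀ ≤ A₁ ≤ ⋯` of structures in `𝒦` -/
  exists_chain : ∃ A : ℕ → L.Substructure M,
    (∀ i, Bundled.of (c := L.Structure) (A i) ∈ K.carrier) ∧
    (∀ i, A i ≤ A (i + 1) ∧
      K.Closed (A (i + 1)) ((A i).comap (A (i + 1)).subtype.toHom)) ∧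
    ∀ x : M, ∃ i, x ∈ A i
  /-- if `A ≤ M` and `A ≤ B ∈ 𝒦` then `B` has a `≤`-embedding into `M` that fixes `A` -/
  extension : ∀ A : L.Substructure M, K.ClosedIn M A →
    ∀ B ∈ K.carrier, ∀ e : K.ClosedEmb A B,
      ∃ h : K.ClosedEmb B M, ∀ a : A, h.1 (e.1 a) = a

/-- `C ⟶ (B)^A_k` for `≤`-embeddings. -/
def Arrow [L.IsRelational] (A B C : Type w) [L.Structure A] [L.Structure B] [L.Structure C]
    (k : ℕ) : Prop :=
  ∀ c : K.ClosedEmb A C → Fin k, ∃ (g : K.ClosedEmb B C) (i : Fin k),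
    ∀ f : K.ClosedEmb A B, c (g.comp f) = i

/-- The `≤`-Ramsey property: for all `A ≤ B` in `𝒦` and `k ≥ 2` there is `C ∈ 𝒦` with `B ≤ C` and
`C ⟶ (B)^A_k`.  (`A ≤ B` and `B ≤ C` are read up to isomorphism, through `≤`-embeddings.) -/
def RamseyProperty [L.IsRelational] : Prop :=
  ∀ A ∈ K.carrier, ∀ B ∈ K.carrier, Nonempty (K.ClosedEmb A B) → ∀ k : ℕ, 2 ≤ k →
    ∃ C ∈ K.carrier, Nonempty (K.ClosedEmb B C) ∧ K.Arrow A B C k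

end SmoothClass

/-- `Aut(M)` as a subgroup of the group of all permutations of `M`. -/
def autGroup (L : FirstOrder.Language.{u, v}) (M : Type w) [L.Structure M] : Subgroup (Equiv.Perm M) where
  carrier := {g | ∃ f : M ≃[L] M, f.toEquiv = g}
  mul_mem' := by
    rintro _ _ ⟨f, rfl⟩ ⟨f', rfl⟩
    exact ⟨f.comp f', rfl⟩
  one_mem' := ⟨FirstOrder.Language.Equiv.refl L M, rfl⟩
  inv_mem' := by
    rintro _ ⟨f, rfl⟩
    exact ⟨f.symm, rfl⟩

/-- The topology of pointwise convergence on `Aut(M)`, where `M` is discrete. -/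
instance autGroup.instTopologicalSpace (L : FirstOrder.Language.{u, v}) (M : Type w) [L.Structure M] :
    TopologicalSpace (autGroup L M) :=
  TopologicalSpace.induced (fun (g : autGroup L M) (x : M) => g.1 x)
    (@Pi.topologicalSpace M (fun _ => M) (fun _ => ⊥))

/-- `G` is extremely amenable: every continuous action of `G` on a nonempty compact Hausdorff space
has a fixed point.  (The greatest ambit of `G` lives in the universe of `G`, so that spaces of that
universe suffice.) -/
def ExtremelyAmenable (G : Type w) [Group G] [TopologicalSpace G] : Prop :=
  ∀ (X : Type w) [TopologicalSpace X] [CompactSpace X] [T2Space X] [Nonempty X]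
    [MulAction G X] [ContinuousSMul G X], ∃ x : X, ∀ g : G, g • x = x

/-- The permutation group `G` of `M` preserves a linear ordering of `M`. -/
def PreservesLinearOrder {M : Type w} (G : Subgroup (Equiv.Perm M)) : Prop :=
  ∃ r : M → M → Prop, IsLinearOrder M r ∧ ∀ g ∈ G, ∀ a b : M, r a b → r (g a) (g b)

/-! A back-and-forth argument makes `M` homogeneous, so `Aut(M)` acts transitively on the
`≤`-embeddings of each finite `A` into `M` (`IsGeneric.exists_smul_eq`).

From (1) to (2): linear orders on `M`, and colourings of `≤`-embeddings `A → M`, live in compact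
spaces on which `Aut(M)` acts continuously. A fixed linear order gives (a). A fixed colouring in the
orbit closure of a given one is constant by transitivity, so the given colouring is monochromatic on
some copy of `B` in `M`; an ultrafilter limit of bad colourings turns this into (b).

From (2) to (1): colouring `≤`-embeddings by approximate positions of translates of one point, the
Ramsey property yields points almost fixed by any finite set of group elements
(`IsGeneric.exists_almost_fixed`). Compactness then gives a fixed point. -/

namespace SmoothClass

open FirstOrder Language

variable {L : FirstOrder.Language.{u, v}} (K : SmoothClass.{u, v, w} L)

/-! ### Closed embeddings -/

variable {K} in
theorem IsClosedEmb.codRestrict {A N : Type w} [L.Structure A] [L.Structure N] {f : A ↪[L] N}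
    (hf : K.IsClosedEmb f) (D : L.Substructure N) (hD : Finite D) (h : ∀ a, f a ∈ D) :
    K.IsClosedEmb (f.codRestrict D h) := by
  have h1 : K.Closed D (f.toHom.range.comap D.subtype.toHom) := by
    refine hf.2 D hD ?_
    rintro _ ⟨a, rfl⟩
    exact h a
  have h2 : (f.codRestrict D h).toHom.range = f.toHom.range.comap D.subtype.toHom := by
    ext x
    constructor
    · rintro ⟨a, rfl⟩
      exact ⟨a, rfl⟩
    · rintro ⟨a, ha⟩
      exact ⟨a, Subtype.ext ha⟩
  rw [IsClosedEmb, h2, K.closedIn_iff_closed _ (K.mem_of_closed _ _ h1)]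
  exact h1

variable {K} in
theorem IsClosedEmb.equiv_comp [L.IsRelational] {A N N' : Type w} [L.Structure A] [L.Structure N]
    [L.Structure N'] {f : A ↪[L] N} (hf : K.IsClosedEmb f) (e : N ≃[L] N') :
    K.IsClosedEmb (e.toEmbedding.comp f) := by
  have := hf.1
  have hA : Finite A := Finite.of_equiv _ f.equivRange.toEquiv.symm
  refine ⟨Finite.of_equiv _ (e.toEmbedding.comp f).equivRange.toEquiv, fun D hD hle => ?_⟩
  let D' : L.Substructure N := D.comap e.toHom
  let k : D' ≃[L] D :=
    { toFun := fun x => ⟨e x.1, x.2⟩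
      invFun := fun x => ⟨e.symm x.1, show e (e.symm x.1) ∈ D by simp⟩
      left_inv := fun x => Subtype.ext (by simp)
      right_inv := fun x => Subtype.ext (by simp)
      map_fun' := fun {n} F => isEmptyElim F
      map_rel' := fun r x => e.map_rel r (fun i => (x i).1) }
  have hD' : Finite D' := Finite.of_equiv _ k.toEquiv.symm
  have hle' : f.toHom.range ≤ D' := by
    rintro _ ⟨a, rfl⟩
    exact hle ⟨a, rfl⟩
  have h := K.closed_map_equiv _ _ k _ (hf.2 D' hD' hle')
  convert h using 1
  ext x
  constructor
  · rintro ⟨a, ha⟩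
    exact ⟨⟨f a, hle' ⟨a, rfl⟩⟩, ⟨a, rfl⟩, Subtype.ext ha⟩
  · rintro ⟨y, ⟨a, ha⟩, rfl⟩
    exact ⟨a, congrArg e ha⟩

variable {K} in
theorem isClosedEmb_congr {A B N : Type w} [L.Structure A] [L.Structure B]
    [L.Structure N] {f : A ↪[L] N} {g : B ↪[L] N} (h : Set.range f = Set.range g) :
    K.IsClosedEmb f ↔ K.IsClosedEmb g := by
  have : f.toHom.range = g.toHom.range := SetLike.coe_injective h
  rw [IsClosedEmb, IsClosedEmb, this]

theorem isClosedEmb_subtype {N : Type w} [L.Structure N] (A : L.Substructure N) :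
    K.IsClosedEmb A.subtype ↔ K.ClosedIn N A := by
  rw [IsClosedEmb, FirstOrder.Language.Substructure.range_subtype]

variable {K} in
theorem ClosedIn.mem {N : Type w} [L.Structure N] {A : L.Substructure N} (h : K.ClosedIn N A) :
    Bundled.of (c := L.Structure) A ∈ K.carrier :=
  K.mem_of_closed _ _ (h.2 A h.1 le_rfl)

theorem notMem_bot [L.IsRelational] {N : Type w} [L.Structure N] (x : N) :
    x ∉ (⊥ : L.Substructure N) := by
  rw [← FirstOrder.Language.Substructure.closure_empty, ← SetLike.mem_coe,
    FirstOrder.Language.Substructure.closure_eq_of_isRelational]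
  exact Set.notMem_empty x

/-! ### Homogeneity of the generic structure -/

namespace IsGeneric

variable {K} {M : Type w} [L.Structure M]

/-- A `(𝒦, ≤)`-generic structure is the union of a chain of finite substructures closed in it. -/
theorem exists_chain_closedIn (hM : K.IsGeneric M) : ∃ A : ℕ → L.Substructure M,
    Monotone A ∧ (∀ i, K.ClosedIn M (A i)) ∧
      ∀ S : Set M, S.Finite → ∃ i, S ⊆ A i := by
  obtain ⟨A, hAK, hA, hx⟩ := hM.exists_chain
  have hmono : Monotone A := monotone_nat_of_le_succ fun i => (hA i).1
  have hfin : ∀ S : Set M, S.Finite → ∃ i, S ⊆ A i := by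
    intro S hS
    choose n hn using hx
    obtain ⟨b, hb⟩ := (hS.image n).bddAbove
    exact ⟨b, fun x hxS => hmono (hb ⟨x, hxS, rfl⟩) (hn x)⟩
  have hAfin : ∀ i, Finite (A i) := fun i => K.finite_of_mem _ (hAK i)
  have hcl : ∀ i j, i ≤ j → K.Closed (A j) ((A i).comap (A j).subtype.toHom) := by
    intro i j hij
    induction j, hij using Nat.le_induction with
    | base =>
      convert K.closed_top _ (hAK i)
      ext x
      simp
    | succ j hij ih =>
      let e : A j ↪[L] A (j + 1) := FirstOrder.Language.Substructure.inclusion (hA j).1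
      have hr : e.toHom.range = (A j).comap (A (j + 1)).subtype.toHom := by
        ext x
        constructor
        · rintro ⟨a, rfl⟩
          exact a.2
        · exact fun hx => ⟨⟨x.1, hx⟩, rfl⟩
      have h1 := K.closed_map_equiv _ _ e.equivRange _ ih
      have h2 : K.Closed (A (j + 1)) e.toHom.range := hr ▸ (hA j).2
      convert K.closed_trans _ _ _ h1 h2
      ext x
      constructor
      · intro hx
        exact ⟨e.equivRange ⟨x.1, hmono hij hx⟩, ⟨_, hx, rfl⟩, rfl⟩
      · rintro ⟨_, ⟨y, hy, rfl⟩, rfl⟩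
        exact hy
  refine ⟨A, hmono, fun i => ⟨hAfin i, fun B hB hle => ?_⟩, hfin⟩
  obtain ⟨j, hj⟩ := hfin B (Set.toFinite _)
  have hij : A i ≤ A j := hle.trans hj
  have h0 : K.Closed (A j) ((A i).comap (A j).subtype.toHom) := by
    rcases le_total i j with h | h
    · exact hcl i j h
    -- `j` was chosen for `B` alone and may lie below `i`; the two members of the chain then
    -- coincide.
    · have : A i = A j := le_antisymm hij (hmono h)
      rw [this]
      convert K.closed_top _ (hAK j)
      ext x
      simp
  let g : A i ↪[L] A j := FirstOrder.Language.Substructure.inclusion hij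
  have hg : K.IsClosedEmb g := by
    have : g.toHom.range = (A i).comap (A j).subtype.toHom := by
      ext x
      constructor
      · rintro ⟨a, rfl⟩
        exact a.2
      · exact fun hx => ⟨⟨x.1, hx⟩, rfl⟩
    rw [IsClosedEmb, this, K.closedIn_iff_closed _ (hAK j)]
    exact h0
  let B' : L.Substructure (A j) := B.comap (A j).subtype.toHom
  let e : B ≃[L] B' :=
    { toFun := fun x => ⟨⟨x.1, hj x.2⟩, x.2⟩
      invFun := fun x => ⟨x.1.1, x.2⟩
      left_inv := fun _ => rfl
      right_inv := fun _ => rfl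
      map_fun' := fun F x => Subtype.ext <| Subtype.ext rfl
      map_rel' := fun _ _ => Iff.rfl }
  have h1 := hg.2 B' (Subtype.finite) (by rintro _ ⟨a, rfl⟩; exact hle a.2)
  convert K.closed_map_equiv _ _ e.symm _ h1
  ext x
  constructor
  · intro hx
    exact ⟨e x, ⟨⟨x.1, hx⟩, rfl⟩, rfl⟩
  · rintro ⟨y, ⟨a, ha⟩, rfl⟩
    change y.1.1 ∈ A i
    have : y.1 = g a := ha.symm
    rw [this]
    exact a.2

/-- The extension property applied over `∅ ≤ M`. -/
theorem exists_closedEmb [L.IsRelational] (hM : K.IsGeneric M) (B : Type w) [L.Structure B]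
    (hB : Bundled.of (c := L.Structure) B ∈ K.carrier) : Nonempty (K.ClosedEmb B M) := by
  have hbot : K.ClosedIn M ⊥ := by
    have hfin : ((⊥ : L.Substructure M) : Set M).Finite :=
      Set.finite_empty.subset fun x hx => notMem_bot x hx
    refine ⟨hfin, fun D hD _ => ?_⟩
    obtain ⟨A, -, hA, hS⟩ := hM.exists_chain_closedIn
    obtain ⟨i, hi⟩ := hS D (Set.toFinite _)
    have hDK : Bundled.of (c := L.Structure) D ∈ K.carrier :=
      K.hereditary _ (hA i).mem ⟨@FirstOrder.Language.Structure.FG.of_finite L D _ hD,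
        ⟨FirstOrder.Language.Substructure.inclusion hi⟩⟩
    convert K.closed_bot D hDK
    ext x
    exact iff_of_false (notMem_bot x.1) (notMem_bot x)
  have hemp : IsEmpty (⊥ : L.Substructure M) := ⟨fun x => notMem_bot x.1 x.2⟩
  -- Nullary relations have to agree on `∅ ⊆ M` and on `B`. They do because `B` also embeds in `M`.
  have hB' : Bundled.of (c := L.Structure) B ∈ L.age M := hM.age_eq ▸ hB
  obtain ⟨ι⟩ : Nonempty (B ↪[L] M) := hB'.2
  let e : (⊥ : L.Substructure M) ↪[L] B :=
    { toFun := fun x => hemp.elim x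
      inj' := fun x => hemp.elim x
      map_fun' := fun F => isEmptyElim F
      map_rel' := fun {n} r x => by
        rw [← ι.map_rel, ← (⊥ : L.Substructure M).subtype.map_rel]
        have : IsEmpty (Fin n) := ⟨fun i => hemp.elim (x i)⟩
        rw [Subsingleton.elim (ι ∘ _) ((⊥ : L.Substructure M).subtype ∘ x)] }
  have he : K.IsClosedEmb e := by
    rw [IsClosedEmb, K.closedIn_iff_closed _ hB]
    convert K.closed_bot B hB
    rw [eq_bot_iff]
    rintro _ ⟨a, -⟩
    exact hemp.elim a
  obtain ⟨h, -⟩ := hM.extension ⊥ hbot _ hB ⟨e, he⟩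
  exact ⟨h⟩

/-- The partial automorphisms of `M` between finite closed substructures. -/
abbrev ClosedPartialEquiv (K : SmoothClass.{u, v, w} L) (M : Type w) [L.Structure M] :=
  {p : M ≃ₚ[L] M // K.ClosedIn M p.dom ∧ K.ClosedIn M p.cod}

/-- A member of the chain containing `x` and the domain of `p` becomes, through `p⁻¹`, a closed
extension of the codomain. Its `≤`-embedding into `M` over that codomain is the extended map. -/
theorem exists_extension_dom (hM : K.IsGeneric M) (p : ClosedPartialEquiv K M) (x : M) :
    ∃ q : ClosedPartialEquiv K M, x ∈ q.1.dom ∧ p ≤ q := by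
  obtain ⟨p, hdom, hcod⟩ := p
  obtain ⟨A, -, hA, hS⟩ := hM.exists_chain_closedIn
  have hfin : (insert x (p.dom : Set M)).Finite := Set.Finite.insert _ hdom.1
  obtain ⟨i, hi⟩ := hS _ hfin
  have hle : p.dom ≤ A i := fun y hy => hi (Or.inr hy)
  let f : p.cod ↪[L] M := p.dom.subtype.comp p.toEquiv.symm.toEmbedding
  have hf : K.IsClosedEmb f := by
    rw [isClosedEmb_congr (g := p.dom.subtype), isClosedEmb_subtype]
    · exact hdom
    · exact (p.toEquiv.symm.surjective.range_comp p.dom.subtype)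
  obtain ⟨h, hh⟩ := hM.extension _ hcod _ (hA i).mem
    ⟨_, hf.codRestrict (A i) (hA i).1 fun a => hle (p.toEquiv.symm a).2⟩
  refine ⟨⟨⟨A i, h.1.toHom.range, h.1.equivRange⟩, hA i, h.2⟩, hi (Or.inl rfl), hle, ?_⟩
  ext d
  have := hh (p.toEquiv d)
  refine Eq.trans ?_ this
  refine congrArg h.1 (Subtype.ext ?_)
  change d.1 = (p.toEquiv.symm (p.toEquiv d)).1
  simp

theorem exists_extension_cod (hM : K.IsGeneric M) (p : ClosedPartialEquiv K M) (x : M) :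
    ∃ q : ClosedPartialEquiv K M, x ∈ q.1.cod ∧ p ≤ q := by
  obtain ⟨q, hx, hq⟩ := hM.exists_extension_dom ⟨p.1.symm, p.2.2, p.2.1⟩ x
  exact ⟨⟨q.1.symm, q.2.2, q.2.1⟩, hx, FirstOrder.Language.PartialEquiv.monotone_symm hq⟩

theorem exists_equiv_extending (hM : K.IsGeneric M) (p : ClosedPartialEquiv K M) :
    ∃ g : M ≃[L] M, ∀ x : p.1.dom, g x = p.1.toEquiv x := by
  have := hM.countable
  obtain ⟨_⟩ := nonempty_encodable M
  -- Back and forth: the left summand lists the points to put in the domain, the right one those for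
  -- the codomain.
  let 𝒟 : M ⊕ M → Order.Cofinal (ClosedPartialEquiv K M) := Sum.elim
    (fun x => ⟨{q | x ∈ q.1.dom}, fun q => hM.exists_extension_dom q x⟩)
    (fun x => ⟨{q | x ∈ q.1.cod}, fun q => hM.exists_extension_cod q x⟩)
  let S : ℕ →o (M ≃ₚ[L] M) := ⟨fun n => (Order.sequenceOfCofinals p 𝒟 n).1,
    fun _ _ h => Order.sequenceOfCofinals.monotone p 𝒟 h⟩
  let F := FirstOrder.Language.DirectLimit.partialEquivLimit S
  have hle : ∀ n, S n ≤ F := FirstOrder.Language.DirectLimit.le_partialEquivLimit S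
  have hdom : F.dom = ⊤ := by
    rw [eq_top_iff]
    intro x _
    exact FirstOrder.Language.PartialEquiv.dom_le_dom (hle _)
      (Order.sequenceOfCofinals.encode_mem p 𝒟 (Sum.inl x))
  have hcod : F.cod = ⊤ := by
    rw [eq_top_iff]
    intro x _
    exact FirstOrder.Language.PartialEquiv.cod_le_cod (hle _)
      (Order.sequenceOfCofinals.encode_mem p 𝒟 (Sum.inr x))
  refine ⟨FirstOrder.Language.PartialEquiv.toEquivOfEqTop hdom hcod, fun x => ?_⟩
  refine (DFunLike.congr_fun
    (FirstOrder.Language.PartialEquiv.toEquivOfEqTop_toEmbedding hdom hcod) x.1).trans ?_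
  rw [FirstOrder.Language.PartialEquiv.toEmbeddingOfEqTop_apply]
  exact congrArg Subtype.val
    (FirstOrder.Language.PartialEquiv.toEquiv_inclusion_apply (hle 0) x)

/-- A generic structure is homogeneous with respect to closed embeddings. -/
theorem homogeneous (hM : K.IsGeneric M) {A : Type w} [L.Structure A] (f g : K.ClosedEmb A M) :
    ∃ e : M ≃[L] M, ∀ a, e (f.1 a) = g.1 a := by
  obtain ⟨e, he⟩ := hM.exists_equiv_extending
    ⟨⟨f.1.toHom.range, g.1.toHom.range, g.1.equivRange.comp f.1.equivRange.symm⟩, f.2, g.2⟩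
  refine ⟨e, fun a => (he (f.1.equivRange a)).trans ?_⟩
  change (g.1.equivRange (f.1.equivRange.symm (f.1.equivRange a))).1 = _
  simp

end IsGeneric

end SmoothClass

/-! ### Fixed points in spaces of colourings -/

section Topology

open Filter Topology

variable {L : FirstOrder.Language.{u, v}} {M : Type w} [L.Structure M]

namespace autGroup

theorem mem_nhds_iff (g₀ : autGroup L M) (U : Set (autGroup L M)) :
    U ∈ 𝓝 g₀ ↔ ∃ S : Set M, S.Finite ∧ ∀ g : autGroup L M, (∀ x ∈ S, g.1 x = g₀.1 x) → g ∈ U := by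
  let _ : TopologicalSpace M := ⊥
  have : DiscreteTopology M := ⟨rfl⟩
  have h : 𝓝 g₀ = comap (fun (g : autGroup L M) (x : M) => g.1 x) (𝓝 fun x => g₀.1 x) :=
    nhds_induced _ _
  rw [h, mem_comap]
  constructor
  · rintro ⟨t, ht, htU⟩
    rw [nhds_pi, Filter.mem_pi] at ht
    obtain ⟨S, hS, s, hs, hst⟩ := ht
    refine ⟨S, hS, fun g hg => htU (hst fun x hx => ?_)⟩
    change g.1 x ∈ s x
    rw [hg x hx]
    exact mem_of_mem_nhds (hs x)
  · rintro ⟨S, hS, hU⟩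
    refine ⟨S.pi fun x => {g₀.1 x}, ?_, fun g hg => hU g fun x hx => hg x hx⟩
    exact set_pi_mem_nhds hS fun x _ => by simp [nhds_discrete]

theorem eventually_inv_smul_eq {I : Type*} [MulAction (autGroup L M) I] {i : I} {S : Set M}
    (hS : S.Finite) (h : ∀ g : autGroup L M, (∀ x ∈ S, g.1 x = x) → g • i = i)
    (g₀ : autGroup L M) : ∀ᶠ g in 𝓝 g₀, g⁻¹ • i = g₀⁻¹ • i := by
  -- If `g` agrees with `g₀` on `g₀⁻¹ S`, then `g₀ g⁻¹` fixes `S` pointwise.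
  refine (mem_nhds_iff g₀ _).2 ⟨g₀⁻¹.1 '' S, hS.image _, fun g hg => ?_⟩
  have h1 : (g₀ * g⁻¹) • i = i := by
    refine h _ fun x hx => ?_
    have h2 : g.1 (g₀.1⁻¹ x) = g₀.1 (g₀.1⁻¹ x) := hg _ ⟨x, hx, rfl⟩
    have h3 : g.1 (g₀.1⁻¹ x) = x := by rw [h2]; simp
    change g₀.1 (g.1⁻¹ x) = x
    rw [Equiv.Perm.inv_eq_iff_eq.2 h3.symm]
    simp
  change g⁻¹ • i = g₀⁻¹ • i
  rw [eq_inv_smul_iff, ← mul_smul, h1]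

end autGroup

/-- An extremely amenable group fixes a point in every nonempty closed invariant set of maps from a
set with finitely supported elements to a finite set. -/
theorem ExtremelyAmenable.exists_invariant (hG : ExtremelyAmenable (autGroup L M)) {I : Type w}
    [MulAction (autGroup L M) I]
    (hI : ∀ i : I, ∃ S : Set M, S.Finite ∧
      ∀ g : autGroup L M, (∀ x ∈ S, g.1 x = x) → g • i = i)
    {E : Type} [Finite E] [TopologicalSpace E] [DiscreteTopology E] (X : Set (I → E))
    (hX : IsClosed X) (hne : X.Nonempty)
    (hinv : ∀ c ∈ X, ∀ g : autGroup L M, (fun i => c (g • i)) ∈ X) :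
    ∃ c ∈ X, ∀ (g : autGroup L M) (i : I), c (g • i) = c i := by
  let _ : MulAction (autGroup L M) X :=
    { smul := fun g c => ⟨fun i => c.1 (g⁻¹ • i), hinv _ c.2 _⟩
      one_smul := fun c => Subtype.ext <| funext fun i => by
        change c.1 ((1 : autGroup L M)⁻¹ • i) = c.1 i
        rw [inv_one, one_smul]
      mul_smul := fun g h c => Subtype.ext <| funext fun i => by
        change c.1 ((g * h)⁻¹ • i) = c.1 (h⁻¹ • g⁻¹ • i)
        rw [mul_inv_rev, mul_smul] }
  have : CompactSpace X := isCompact_iff_compactSpace.1 hX.isCompact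
  have : Nonempty X := hne.to_subtype
  -- In each coordinate the action evaluates at `g⁻¹ • i`, which is locally constant in `g`.
  have : ContinuousSMul (autGroup L M) X := by
    refine ⟨Continuous.subtype_mk (continuous_pi fun i => ?_) _⟩
    rw [continuous_iff_continuousAt]
    rintro ⟨g₀, c₀⟩
    obtain ⟨S, hS, h⟩ := hI i
    have h1 : ContinuousAt (fun p : autGroup L M × X => p.2.1 (g₀⁻¹ • i)) (g₀, c₀) :=
      ((continuous_apply (g₀⁻¹ • i)).comp (continuous_subtype_val.comp
        continuous_snd)).continuousAt
    refine h1.congr ?_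
    have h2 : ∀ᶠ p : autGroup L M × X in 𝓝 (g₀, c₀), p.1⁻¹ • i = g₀⁻¹ • i :=
      (continuous_fst.tendsto (g₀, c₀)).eventually
        (autGroup.eventually_inv_smul_eq hS h g₀)
    filter_upwards [h2] with p hp
    rw [hp]
  obtain ⟨c, hc⟩ := hG X
  refine ⟨c.1, c.2, fun g i => ?_⟩
  have h1 := congrFun (congrArg Subtype.val (hc g⁻¹)) i
  change c.1 (g⁻¹⁻¹ • i) = c.1 i at h1
  rwa [inv_inv] at h1

/-- Each order axiom instance involves finitely many coordinates, so linear orders form a closed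
set; an injection into `ℕ` shows that it is nonempty. -/
theorem ExtremelyAmenable.preservesLinearOrder [Countable M]
    (hG : ExtremelyAmenable (autGroup L M)) : PreservesLinearOrder (autGroup L M) := by
  obtain ⟨e, he⟩ := exists_injective_nat M
  let X : Set (M × M → Bool) := {r | (∀ a, r (a, a) = true) ∧
    (∀ a b, r (a, b) = true → r (b, a) = true → a = b) ∧
    (∀ a b c, r (a, b) = true → r (b, c) = true → r (a, c) = true) ∧
    ∀ a b, r (a, b) = true ∨ r (b, a) = true}
  have hclosed {α : Type} [TopologicalSpace α] [DiscreteTopology α] (f : (M × M → Bool) → α)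
      (hf : Continuous f) (P : α → Prop) : IsClosed {r | P (f r)} :=
    (isClosed_discrete {a | P a}).preimage hf
  have hX : IsClosed X := by
    simp only [X, Set.ofPred_and, Set.ofPred_forall]
    refine IsClosed.inter ?_ (IsClosed.inter ?_ (IsClosed.inter ?_ ?_))
    · exact isClosed_iInter fun a => hclosed (fun r => r (a, a)) (continuous_apply (a, a))
        (fun x => x = true)
    · exact isClosed_iInter fun a => isClosed_iInter fun b =>
        hclosed (fun r => (r (a, b), r (b, a)))
        ((continuous_apply (a, b)).prodMk (continuous_apply (b, a)))
        (fun x => x.1 = true → x.2 = true → a = b)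
    · exact isClosed_iInter fun a => isClosed_iInter fun b => isClosed_iInter fun c =>
        hclosed (fun r => (r (a, b), r (b, c), r (a, c)))
        ((continuous_apply (a, b)).prodMk
          ((continuous_apply (b, c)).prodMk (continuous_apply (a, c))))
        (fun x => x.1 = true → x.2.1 = true → x.2.2 = true)
    · exact isClosed_iInter fun a => isClosed_iInter fun b =>
        hclosed (fun r => (r (a, b), r (b, a)))
        ((continuous_apply (a, b)).prodMk (continuous_apply (b, a)))
        (fun x => x.1 = true ∨ x.2 = true)
  obtain ⟨r, ⟨h1, h2, h3, h4⟩, hr⟩ := hG.exists_invariant (I := M × M)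
    (fun i => ⟨{i.1, i.2}, Set.toFinite _, fun g hg =>
      Prod.ext (hg i.1 (Or.inl rfl)) (hg i.2 (Or.inr rfl))⟩) X hX
    ⟨fun i => decide (e i.1 ≤ e i.2), by
      refine ⟨fun a => ?_, fun a b => ?_, fun a b c => ?_, fun a b => ?_⟩ <;>
        simp only [decide_eq_true_eq]
      · exact le_rfl
      · exact fun h h' => he (le_antisymm h h')
      · exact le_trans
      · exact le_total _ _⟩
    (fun c hc g => ⟨fun a => hc.1 _,
      fun a b h h' => g.1.injective (hc.2.1 _ _ h h'),
      fun a b c => hc.2.2.1 _ _ _, fun a b => hc.2.2.2 _ _⟩)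
  refine ⟨fun a b => r (a, b) = true, ?_, fun g hg a b h => ?_⟩
  · exact { refl := h1, antisymm := h2, trans := h3, total := h4 }
  · exact (hr ⟨g, hg⟩ (a, b)).trans h

end Topology

/-! ### From extreme amenability to the Ramsey property -/

namespace autGroup

variable {L : FirstOrder.Language.{u, v}} {M : Type w} [L.Structure M]

/-- An element of `Aut(M)` as an automorphism of the structure `M`. -/
def toEquiv (g : autGroup L M) : M ≃[L] M where
  toEquiv := g.1
  map_fun' := by
    obtain ⟨_, f, rfl⟩ := g
    exact f.map_fun'
  map_rel' := by
    obtain ⟨_, f, rfl⟩ := g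
    exact f.map_rel'

end autGroup

namespace SmoothClass

open Filter Topology

theorem ClosedEmb.ext {L : FirstOrder.Language.{u, v}} {K : SmoothClass.{u, v, w} L}
    {A N : Type w} [L.Structure A] [L.Structure N] {f g : K.ClosedEmb A N}
    (h : ∀ a, f.1 a = g.1 a) : f = g :=
  Subtype.ext (FirstOrder.Language.Embedding.ext h)

variable {L : FirstOrder.Language.{u, v}} [L.IsRelational] {K : SmoothClass.{u, v, w} L}

instance ClosedEmb.instMulAction {A M : Type w} [L.Structure A] [L.Structure M] :
    MulAction (autGroup L M) (K.ClosedEmb A M) where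
  smul g f := ⟨(autGroup.toEquiv g).toEmbedding.comp f.1, f.2.equiv_comp _⟩
  one_smul _ := rfl
  mul_smul _ _ _ := rfl

instance ClosedEmb.instFinite {A N : Type w} [L.Structure A] [L.Structure N] [Finite A]
    [Finite N] : Finite (K.ClosedEmb A N) :=
  Finite.of_injective (fun f (a : A) => f.1 a) fun _ _ h => ClosedEmb.ext (congrFun h)

variable {M : Type w} [L.Structure M]

theorem IsGeneric.exists_smul_eq (hM : K.IsGeneric M) {A : Type w} [L.Structure A]
    (f f' : K.ClosedEmb A M) : ∃ g : autGroup L M, g • f = f' := by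
  obtain ⟨e, he⟩ := hM.homogeneous f f'
  exact ⟨⟨e.toEquiv, e, rfl⟩, ClosedEmb.ext he⟩

theorem IsGeneric.exists_monochromatic (hM : K.IsGeneric M)
    (hG : ExtremelyAmenable (autGroup L M)) {A B : Type w} [L.Structure A] [L.Structure B]
    [Finite A] [Finite B] (f₀ : K.ClosedEmb A B) (g₀ : K.ClosedEmb B M) {k : ℕ}
    (c : K.ClosedEmb A M → Fin k) :
    ∃ (g : K.ClosedEmb B M) (i : Fin k), ∀ f : K.ClosedEmb A B, c (g.comp f) = i := by
  let O : Set (K.ClosedEmb A M → Fin k) := Set.range fun (g : autGroup L M) f => c (g • f)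
  obtain ⟨d, hdO, hd⟩ := hG.exists_invariant (I := K.ClosedEmb A M)
    (fun f => ⟨Set.range f.1, Set.finite_range _, fun g hg =>
      ClosedEmb.ext fun a => hg _ ⟨a, rfl⟩⟩) (closure O) isClosed_closure
    (Set.Nonempty.closure ⟨_, 1, rfl⟩) (by
      intro d hd g
      have hcont : Continuous fun (d : K.ClosedEmb A M → Fin k) f => d (g • f) := by fun_prop
      refine map_mem_closure hcont hd ?_
      rintro _ ⟨h, rfl⟩
      refine ⟨h * g, funext fun f => ?_⟩
      change c ((h * g) • f) = c (h • g • f)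
      rw [mul_smul])
  -- Only finitely many `f` exist, so some translate of `c` agrees with the invariant `d` on all
  -- copies of `A` inside `g₀[B]`; by transitivity `d` is constant.
  have hev : ∀ᶠ d' in 𝓝 d, ∀ f : K.ClosedEmb A B, d' (g₀.comp f) = d (g₀.comp f) := by
    rw [eventually_all]
    intro f
    have h := (continuous_apply (g₀.comp f)).continuousAt (x := d)
    exact h.eventually (show {d (g₀.comp f)} ∈ 𝓝 (d (g₀.comp f)) by simp [nhds_discrete])
  obtain ⟨_, hmem, g, rfl⟩ := mem_closure_iff_nhds.1 hdO _ hev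
  refine ⟨g • g₀, d (g₀.comp f₀), fun f => ?_⟩
  obtain ⟨h, hh⟩ := hM.exists_smul_eq (g₀.comp f) (g₀.comp f₀)
  rw [← hh, hd]
  exact hmem f

theorem IsGeneric.ramseyProperty (hM : K.IsGeneric M)
    (hG : ExtremelyAmenable (autGroup L M)) : K.RamseyProperty := by
  rintro ⟨A, _⟩ hA ⟨B, _⟩ hB ⟨f₀⟩ k hk
  have hAfin : Finite A := K.finite_of_mem _ hA
  have hBfin : Finite B := K.finite_of_mem _ hB
  obtain ⟨g₀⟩ := hM.exists_closedEmb B hB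
  obtain ⟨C, hmono, hC, hS⟩ := hM.exists_chain_closedIn
  by_contra hcon
  have : NeZero k := ⟨by omega⟩
  have hbad : ∀ n, ∃ c : K.ClosedEmb A (C n) → Fin k, ∀ g : K.ClosedEmb B (C n),
      ¬ ∃ i, ∀ f : K.ClosedEmb A B, c (g.comp f) = i := by
    intro n
    by_cases hne : Nonempty (K.ClosedEmb B (C n))
    -- Once `B` `≤`-embeds in `C n`, a failing arrow supplies the bad colouring; otherwise every
    -- colouring is bad.
    · by_contra hn
      push Not at hn
      exact hcon ⟨_, (hC n).mem, hne, hn⟩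
    · exact ⟨fun _ => 0, fun g => (hne ⟨g⟩).elim⟩
  choose c hc using hbad
  let restr {D : Type w} [L.Structure D] (f : K.ClosedEmb D M) (n : ℕ) (h : ∀ a, f.1 a ∈ C n) :
      K.ClosedEmb D (C n) := ⟨f.1.codRestrict (C n) h, f.2.codRestrict (C n) (hC n).1 h⟩
  classical
  -- The value `0` is used for only finitely many `n`, so it does not affect the limit along `U`.
  let φ (f : K.ClosedEmb A M) (n : ℕ) : Fin k :=
    if h : ∀ a, f.1 a ∈ C n then c n (restr f n h) else 0
  let U : Ultrafilter ℕ := Ultrafilter.of atTop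
  have hlim : ∀ f, ∃ i, ∀ᶠ n in U, φ f n = i := by
    intro f
    obtain ⟨i, hi⟩ := Ultrafilter.eq_pure_of_finite (U.map (φ f))
    refine ⟨i, ?_⟩
    have h1 : {i} ∈ U.map (φ f) := by rw [hi]; exact Set.mem_singleton i
    exact h1
  choose d hd using hlim
  obtain ⟨g, i, hg⟩ := hM.exists_monochromatic hG f₀ g₀ d
  have h1 : ∀ᶠ n in U, ∀ f : K.ClosedEmb A B, φ (g.comp f) n = i := by
    rw [eventually_all]
    intro f
    rw [← hg f]
    exact hd _
  have h2 : ∀ᶠ n in (U : Filter ℕ), ∀ b, g.1 b ∈ C n := by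
    obtain ⟨n, hn⟩ := hS _ (Set.finite_range g.1)
    refine Ultrafilter.of_le atTop ?_
    filter_upwards [eventually_ge_atTop n] with m hm b
    exact hmono hm (hn ⟨b, rfl⟩)
  obtain ⟨n, hn1, hn2⟩ := (h1.and h2).exists
  refine hc n (restr g n hn2) ⟨i, fun f => ?_⟩
  have h3 : φ (g.comp f) n = c n (restr (g.comp f) n fun a => hn2 (f.1 a)) := dif_pos _
  rw [← hn1 f, h3]
  rfl

end SmoothClass

/-! ### From the Ramsey property to extreme amenability -/

namespace SmoothClass

open Filter Topology Uniformity

variable {L : FirstOrder.Language.{u, v}} [L.IsRelational] {K : SmoothClass.{u, v, w} L}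
  {M : Type w} [L.Structure M]

theorem IsGeneric.exists_almost_fixed (hM : K.IsGeneric M) (hR : K.RamseyProperty)
    {X : Type*} [UniformSpace X] [CompactSpace X] [Nonempty X]
    [MulAction (autGroup L M) X] [ContinuousSMul (autGroup L M) X]
    {F : Set (autGroup L M)} (hF : F.Finite) {V : Set (X × X)} (hV : V ∈ 𝓤 X) :
    ∃ x : X, ∀ g ∈ F, (g • x, x) ∈ V := by
  obtain ⟨W', hW', hsymm', hcomp'⟩ := comp_symm_mem_uniformity_sets hV
  obtain ⟨W, hW, -, hcomp⟩ := comp_symm_mem_uniformity_sets hW'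
  -- By compactness, elements near `1` move all points by less than `W`; in particular this holds
  -- for the stabilizer of `f₀` below.
  have hunif : ∀ᶠ h : autGroup L M in 𝓝 1, ∀ y ∈ (Set.univ : Set X), (h • y, y) ∈ W := by
    refine isCompact_univ.eventually_forall_of_forall_eventually fun y _ => ?_
    have hcont : Continuous fun z : autGroup L M × X => (z.1 • z.2, z.2) :=
      (continuous_fst.smul continuous_snd).prodMk continuous_snd
    refine (hcont.tendsto (1, y)).eventually ?_
    rw [one_smul]
    exact nhds_le_uniformity y hW
  obtain ⟨S, hS, hSW⟩ := (autGroup.mem_nhds_iff _ _).1 hunif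
  obtain ⟨C, -, hC, hCS⟩ := hM.exists_chain_closedIn
  obtain ⟨m, hm⟩ := hCS S hS
  let A := C m
  have hA : Finite A := (hC m).1
  let f₀ : K.ClosedEmb A M := ⟨A.subtype, (K.isClosedEmb_subtype A).2 (hC m)⟩
  obtain ⟨x₀⟩ := ‹Nonempty X›
  obtain ⟨t, ht, htX⟩ := (isCompact_univ (X := X)).totallyBounded W hW
  have : Finite t := ht
  obtain ⟨n, ⟨et⟩⟩ := Finite.exists_equiv_fin t
  have hcov : ∀ x : X, ∃ y : t, (x, y.1) ∈ W := fun x => by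
    obtain ⟨y, hy, hxy⟩ := Set.mem_iUnion₂.1 (htX (Set.mem_univ x))
    exact ⟨⟨y, hy⟩, hxy⟩
  choose idx hidx using hcov
  choose G hG using fun f : K.ClosedEmb A M => hM.exists_smul_eq f f₀
  -- The colour of `f` is a net point near `g • x₀`, where `g • f = f₀`. The choice of `g` matters
  -- only up to `W`. The two extra colours ensure `k ≥ 2`.
  let c (f : K.ClosedEmb A M) : Fin (n + 2) := Fin.castAdd 2 (et (idx (G f • x₀)))
  have hnear : ∀ (f : K.ClosedEmb A M) (g : autGroup L M), g • f = f₀ →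
      (g • x₀, (idx (G f • x₀)).1) ∈ W' := by
    intro f g hg
    have h1 : (g * (G f)⁻¹) • f₀ = f₀ := by
      rw [mul_smul, ← hG f, inv_smul_smul, hg, hG]
    have h2 : ((g * (G f)⁻¹) • G f • x₀, G f • x₀) ∈ W := by
      refine hSW (g * (G f)⁻¹) (fun x hx => ?_) _ (Set.mem_univ _)
      exact DFunLike.congr_fun (congrArg Subtype.val h1) (⟨x, hm hx⟩ : A)
    rw [mul_smul, inv_smul_smul] at h2
    exact hcomp ⟨_, h2, hidx _⟩
  -- `B` will contain `g⁻¹ A` for every `g` in `F ∪ {1}`.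
  have hfin : (⋃ g ∈ insert 1 F, Set.range (g⁻¹ • f₀).1).Finite :=
    (hF.insert 1).biUnion fun g _ => Set.finite_range _
  obtain ⟨j, hj⟩ := hCS _ hfin
  let B := C j
  let f (g : autGroup L M) (hg : g ∈ insert 1 F) : K.ClosedEmb A B :=
    ⟨_, (g⁻¹ • f₀).2.codRestrict B (hC j).1 fun a => hj (Set.mem_biUnion hg ⟨a, rfl⟩)⟩
  obtain ⟨D, hD, -, hArr⟩ := hR _ (hC m).mem _ (hC j).mem ⟨f 1 (Set.mem_insert _ _)⟩ (n + 2)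
    (Nat.le_add_left 2 n)
  obtain ⟨η⟩ := hM.exists_closedEmb D hD
  obtain ⟨l, i, hl⟩ := hArr fun f => c (η.comp f)
  -- `γ` carries `B` to its monochromatic copy, so all `γ g⁻¹ f₀` share a colour. As `g γ⁻¹` returns
  -- `γ g⁻¹ f₀` to `f₀`, every `g γ⁻¹ x₀` is near the same net point, and `γ⁻¹ x₀` is almost fixed.
  obtain ⟨γ, hγ⟩ := hM.exists_smul_eq (⟨B.subtype, (K.isClosedEmb_subtype B).2 (hC j)⟩) (η.comp l)
  have hc : ∀ g ∈ insert 1 F, c (γ • g⁻¹ • f₀) = i := by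
    intro g hg
    rw [← hl (f g hg)]
    refine congrArg c (ClosedEmb.ext fun a => ?_)
    exact DFunLike.congr_fun (congrArg Subtype.val hγ) ((f g hg).1 a)
  have hclose : ∀ g ∈ insert 1 F,
      (g • γ⁻¹ • x₀, (idx (G (γ • (1 : autGroup L M)⁻¹ • f₀) • x₀)).1) ∈ W' := by
    intro g hg
    have h1 : idx (G (γ • (1 : autGroup L M)⁻¹ • f₀) • x₀) = idx (G (γ • g⁻¹ • f₀) • x₀) := by
      have h2 := (hc 1 (Set.mem_insert _ _)).trans (hc g hg).symm
      exact et.injective (Fin.castAdd_injective n 2 h2)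
    rw [h1, ← mul_smul]
    exact hnear _ _ (by rw [mul_smul, inv_smul_smul, smul_inv_smul])
  refine ⟨γ⁻¹ • x₀, fun g hg => hcomp' ⟨_, hclose g (Set.mem_insert_of_mem _ hg), ?_⟩⟩
  have h := hclose 1 (Set.mem_insert _ _)
  rw [one_smul] at h
  exact hsymm'.symm _ _ h

/-- For closed entourages the sets of almost fixed points are closed with the finite intersection
property. A common point is fixed because closed entourages form a basis and `X` is Hausdorff. -/
theorem IsGeneric.extremelyAmenable (hM : K.IsGeneric M) (hR : K.RamseyProperty) :
    ExtremelyAmenable (autGroup L M) := by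
  intro X _ _ _ _ _ _
  let _ : UniformSpace X := uniformSpaceOfCompactR1
  let T (p : autGroup L M × {V : Set (X × X) // V ∈ 𝓤 X ∧ IsClosed V}) : Set X :=
    {x | (p.1 • x, x) ∈ p.2.1}
  have hT : (⋂ p, T p).Nonempty := by
    refine CompactSpace.iInter_nonempty (fun p => ?_) fun u => ?_
    · exact p.2.2.2.preimage ((continuous_const_smul p.1).prodMk continuous_id)
    · obtain ⟨x, hx⟩ := hM.exists_almost_fixed hR (X := X) (u.finite_toSet.image Prod.fst)
        ((Filter.biInter_finset_mem u).2 fun p _ => p.2.2.1)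
      refine ⟨x, Set.mem_iInter₂.2 fun p hp => ?_⟩
      exact Set.mem_iInter₂.1 (hx p.1 ⟨p, hp, rfl⟩) p hp
  obtain ⟨x, hx⟩ := hT
  refine ⟨x, fun g => eq_of_uniformity_basis uniformity_hasBasis_closed fun {V} hV => ?_⟩
  exact Set.mem_iInter.1 hx (g, ⟨V, hV⟩)

end SmoothClass

theorem mainTheorem6 (L : FirstOrder.Language.{u, v}) [L.IsRelational] [Finite L.Symbols]
    (K : SmoothClass.{u, v, w} L) (hAP : K.Amalgamation)
    (M : Type w) [L.Structure M] (hM : K.IsGeneric M) :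
    ExtremelyAmenable (autGroup L M) ↔
      PreservesLinearOrder (autGroup L M) ∧ K.RamseyProperty := by
  have := hM.countable
  exact ⟨fun h => ⟨h.preservesLinearOrder, hM.ramseyProperty h⟩,
    fun h => hM.extremelyAmenable h.2⟩
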